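/- Let $N$ be a simply connected 2-step nilpotent real Lie group (in its Lie algebra $\mathfrak N = T_eN$ all double brackets vanish, and $\mathfrak N$ is not abelian) with a left invariant Riemannian metric, and let $\langle\,,\rangle$ be the inner product it induces on $\mathfrak N$. Let $\mathfrak Z$ be the center of $\mathfrak N$ and $\mathfrak V = \mathfrak Z^{\perp}$. For $Z\in\mathfrak N$ let $j(Z):\mathfrak V\to\mathfrak V$ be the skew-symmetric linear map with $\langle j(Z)X,Y\rangle=\langle [X,Y],Z\rangle$ for all $X,Y\in\mathfrak V$, and let $\gamma_Z(t)=\exp(tZ)$. For $t>0$ the point $\gamma_Z(t)$ is called conjugate to $e=\gamma_Z(0)$ along $\gamma_Z$ if $\gamma_Z$ is a geodesic and there is a Jacobi vector field along $\gamma_Z$, not identically zero, that vanishes at $0$ and at $t$. Let $Z\in[\mathfrak N,\mathfrak N]$ be nonzero. Then: (1) for every $t>0$, the point $\gamma_Z(t)$ is conjugate to $e$ along $\gamma_Z$ if and only if $t = 2m\pi/\lambda$ for some positive integer $m$ and some real $\lambda>0$ such that $i\lambda$ is a (complex) eigenvalue of $j(Z)$; (2) consequently, if $\gamma_Z(t)$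 is conjugate to $e$ along $\gamma_Z$ for some $t>0$, then $\gamma_Z(mt)$ is conjugate to $e$ along $\gamma_Z$ for every positive integer $m$. -/

import Mathlib

open Bundle Manifold
open scoped ContDiff Manifold

noncomputable section LeftInvariantGeometry

set_option linter.unusedSectionVars false

/- Throughout, `N` is a real Lie group: a smooth manifold modelled on the finite dimensional space
`E` with smooth group operations. Its Lie algebra is Mathlib's `GroupLieAlgebra 𝓘(ℝ, E) N`, that is
the tangent space at the identity with the bracket of left invariant vector fields. A Riemannian
metric on `N` is Mathlib's `RiemannianBundle` structure on the tangent bundle, with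
`IsContMDiffRiemannianBundle` for its smoothness. -/

/-- A `C^∞` Lie group is a `C^3` Lie group, which is what Mathlib asks for in order to have the Lie
bracket on `GroupLieAlgebra`. -/
instance instLEInftyMinSmoothness : ENat.LEInfty (minSmoothness ℝ 3) := ⟨by
  rw [minSmoothness_of_isRCLikeNormedField]; exact ENat.LEInfty.out⟩

section LieAlgebraOnly

/-- A Lie algebra is 2-step nilpotent: all double brackets vanish, and it is not abelian. -/
def IsTwoStepNilpotent (L : Type*) [LieRing L] : Prop :=
  (∀ X Y W : L, ⁅⁅X, Y⁆, W⁆ = 0) ∧ ∃ X Y : L, ⁅X, Y⁆ ≠ 0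

end LieAlgebraOnly

section Exponential

variable {E : Type*} [NormedAddCommGroup E] [NormedSpace ℝ E] [FiniteDimensional ℝ E]
  {N : Type*} [TopologicalSpace N] [ChartedSpace E N] [Group N] [LieGroup 𝓘(ℝ, E) ∞ N]

theorem mfderiv_mul_left_mulInvariantVectorField (Z : GroupLieAlgebra 𝓘(ℝ, E) N) (x y : N) :
    (mfderiv 𝓘(ℝ, E) 𝓘(ℝ, E) (x * ·) y (mulInvariantVectorField Z y) : E) =
      mulInvariantVectorField Z (x * y) := by
  have hd : ∀ a b : N, MDifferentiableAt 𝓘(ℝ, E) 𝓘(ℝ, E) (a * ·) b := fun a b ↦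
    (contMDiff_mul_left (I := 𝓘(ℝ, E)) (n := ∞)).contMDiffAt.mdifferentiableAt (by simp)
  have hc : (fun z : N ↦ x * y * z) = (fun z ↦ x * z) ∘ (fun z ↦ y * z) := by
    ext z; simp [mul_assoc]
  have h := mfderiv_comp (I := 𝓘(ℝ, E)) (I' := 𝓘(ℝ, E)) (I'' := 𝓘(ℝ, E)) (1 : N)
    (g := fun z : N ↦ x * z) (f := fun z : N ↦ y * z) (hd x (y * 1)) (hd y 1)
  have key : ∀ w : N, y * 1 = w →
      (mfderiv 𝓘(ℝ, E) 𝓘(ℝ, E) (x * ·) w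
        (show TangentSpace 𝓘(ℝ, E) w from mfderiv 𝓘(ℝ, E) 𝓘(ℝ, E) (y * ·) (1 : N) Z) : E) =
      mfderiv 𝓘(ℝ, E) 𝓘(ℝ, E) (x * y * ·) (1 : N) Z := by
    rintro _ rfl
    rw [hc, h]
    rfl
  exact key y (mul_one y)

/-- The left invariant vector field of `Z` has a global integral curve through the identity. -/
theorem exists_isMIntegralCurve_mulInvariantVectorField [T2Space N]
    (Z : GroupLieAlgebra 𝓘(ℝ, E) N) :
    ∃ γ : ℝ → N, γ 0 = 1 ∧ IsMIntegralCurve γ (mulInvariantVectorField Z) := by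
  have hv : ContMDiff 𝓘(ℝ, E) 𝓘(ℝ, E).tangent 1
      (fun x : N ↦ (⟨x, mulInvariantVectorField Z x⟩ : TangentBundle 𝓘(ℝ, E) N)) :=
    (contMDiff_mulInvariantVectorField Z).of_le (by simp)
  obtain ⟨γ, hγ0, hγ⟩ := exists_isMIntegralCurveAt_of_contMDiffAt_boundaryless
    (t₀ := 0) (hv.contMDiffAt (x := (1 : N)))
  obtain ⟨ε, hε, hγ⟩ := isMIntegralCurveAt_iff'.1 hγ
  refine exists_isMIntegralCurve_of_isMIntegralCurveOn hv hε (fun x ↦ ⟨fun t ↦ x * γ t, ?_, ?_⟩) 1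
  · simp [hγ0]
  · intro t ht
    have ht' : t ∈ Metric.ball (0 : ℝ) ε := by
      simpa [Real.ball_eq_Ioo] using ht
    have h1 := (hγ t ht').hasMFDerivAt (Metric.isOpen_ball.mem_nhds ht')
    have h2 : HasMFDerivAt 𝓘(ℝ, E) 𝓘(ℝ, E) (x * ·) (γ t) _ :=
      ((contMDiff_mul_left (I := 𝓘(ℝ, E)) (n := ∞) (a := x)).contMDiffAt.mdifferentiableAt
        (by simp)).hasMFDerivAt
    have h3 := (h2.comp t h1).hasMFDerivWithinAt (s := Set.Ioo (-ε) ε)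
    refine h3.congr_mfderiv ?_
    ext
    have := mfderiv_mul_left_mulInvariantVectorField Z x (γ t)
    have e1 : (1 : ℝ) • (mulInvariantVectorField Z (γ t) : E) = mulInvariantVectorField Z (γ t) :=
      one_smul ℝ _
    have e2 : (1 : ℝ) • (mulInvariantVectorField Z (x * γ t) : E) =
        mulInvariantVectorField Z (x * γ t) := one_smul ℝ _
    exact ((congrArg (mfderiv 𝓘(ℝ, E) 𝓘(ℝ, E) (x * ·) (γ t)) e1).trans this).trans e2.symm

/-- The Lie group exponential map: `lieExp Z` is the value at time `1` of the integral curve through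
the identity of the left invariant vector field determined by `Z`. -/
def lieExp [T2Space N] (Z : GroupLieAlgebra 𝓘(ℝ, E) N) : N :=
  (exists_isMIntegralCurve_mulInvariantVectorField Z).choose 1

theorem lieExp_smul_eq [T2Space N] (Z : GroupLieAlgebra 𝓘(ℝ, E) N) (t : ℝ) :
    lieExp (t • Z) = (exists_isMIntegralCurve_mulInvariantVectorField Z).choose t := by
  have hv : ContMDiff 𝓘(ℝ, E) 𝓘(ℝ, E).tangent 1
      (fun x : N ↦ (⟨x, mulInvariantVectorField (t • Z) x⟩ : TangentBundle 𝓘(ℝ, E) N)) :=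
    (contMDiff_mulInvariantVectorField (t • Z)).of_le (by simp)
  have h1 := (exists_isMIntegralCurve_mulInvariantVectorField Z).choose_spec
  have h2 := (exists_isMIntegralCurve_mulInvariantVectorField (t • Z)).choose_spec
  have h3 := h1.2.comp_mul t
  rw [← mulInvariantVectorField_smul] at h3
  have h4 := isMIntegralCurve_Ioo_eq_of_contMDiff_boundaryless (t₀ := 0) hv h2.2 h3
    (by simp [h1.1, h2.1])
  have h5 := congrFun h4 1
  simpa [lieExp] using h5

/-- The curve `t ↦ exp (t Z)` is the integral curve through the identity of the left invariant
vector field determined by `Z`. -/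
theorem isMIntegralCurve_lieExp [T2Space N] (Z : GroupLieAlgebra 𝓘(ℝ, E) N) :
    lieExp ((0 : ℝ) • Z) = 1 ∧
      IsMIntegralCurve (fun t : ℝ ↦ lieExp (t • Z)) (mulInvariantVectorField Z) := by
  have h := (exists_isMIntegralCurve_mulInvariantVectorField Z).choose_spec
  refine ⟨(lieExp_smul_eq Z 0).trans h.1, ?_⟩
  have he : (fun t : ℝ ↦ lieExp (t • Z)) =
      (exists_isMIntegralCurve_mulInvariantVectorField Z).choose := funext (lieExp_smul_eq Z)
  rw [he]
  exact h.2

end Exponential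

section AlongCurves

variable {E : Type*} [NormedAddCommGroup E] [NormedSpace ℝ E] [FiniteDimensional ℝ E]
  {N : Type*} [TopologicalSpace N] [ChartedSpace E N] [Group N] [LieGroup 𝓘(ℝ, E) ∞ N]
  [RiemannianBundle (fun x : N ↦ TangentSpace 𝓘(ℝ, E) x)]

variable (E N) in
/-- The inner product on the Lie algebra is the Riemannian metric at the identity. -/
instance instNormedAddCommGroupGroupLieAlgebra :
    NormedAddCommGroup (GroupLieAlgebra 𝓘(ℝ, E) N) :=
  inferInstanceAs (NormedAddCommGroup (TangentSpace 𝓘(ℝ, E) (1 : N)))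

variable (E N) in
instance instInnerProductSpaceGroupLieAlgebra :
    InnerProductSpace ℝ (GroupLieAlgebra 𝓘(ℝ, E) N) :=
  inferInstanceAs (InnerProductSpace ℝ (TangentSpace 𝓘(ℝ, E) (1 : N)))

variable (E N) in
instance instFiniteDimensionalGroupLieAlgebra :
    FiniteDimensional ℝ (GroupLieAlgebra 𝓘(ℝ, E) N) :=
  inferInstanceAs (FiniteDimensional ℝ E)

variable (E N) in
/-- The Riemannian metric of `N` is left invariant: all left translations are isometries. -/
def IsLeftInvariantMetric : Prop :=
  ∀ (g h : N) (u v : TangentSpace 𝓘(ℝ, E) h),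
    inner ℝ (mfderiv 𝓘(ℝ, E) 𝓘(ℝ, E) (g * ·) h u : TangentSpace 𝓘(ℝ, E) (g * h))
      (mfderiv 𝓘(ℝ, E) 𝓘(ℝ, E) (g * ·) h v : TangentSpace 𝓘(ℝ, E) (g * h)) = inner ℝ u v

theorem inner_mulInvariantVectorField (hinv : IsLeftInvariantMetric E N)
    (a b : GroupLieAlgebra 𝓘(ℝ, E) N) (x : N) :
    inner ℝ (mulInvariantVectorField a x) (mulInvariantVectorField b x) = inner ℝ a b := by
  have key : ∀ (y : N), x * 1 = y → inner ℝ (E := TangentSpace 𝓘(ℝ, E) y)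
      (mfderiv 𝓘(ℝ, E) 𝓘(ℝ, E) (x * ·) 1 a) (mfderiv 𝓘(ℝ, E) 𝓘(ℝ, E) (x * ·) 1 b) =
        inner ℝ a b := by
    rintro _ rfl
    exact hinv x 1 a b
  exact key x (mul_one x)

theorem exists_mulInvariantVectorField_eq (hinv : IsLeftInvariantMetric E N)
    (x : N) (u : TangentSpace 𝓘(ℝ, E) x) :
    ∃ a : GroupLieAlgebra 𝓘(ℝ, E) N, mulInvariantVectorField a x = u := by
  let L : GroupLieAlgebra 𝓘(ℝ, E) N →ₗ[ℝ] TangentSpace 𝓘(ℝ, E) x :=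
    { toFun := fun a ↦ mulInvariantVectorField a x
      map_add' := fun a b ↦ by rw [mulInvariantVectorField_add]; rfl
      map_smul' := fun c a ↦ by rw [mulInvariantVectorField_smul]; rfl }
  have hfd : FiniteDimensional ℝ (TangentSpace 𝓘(ℝ, E) x) := inferInstanceAs (FiniteDimensional ℝ E)
  have hinj : Function.Injective L := by
    rw [injective_iff_map_eq_zero]
    intro a ha
    have := inner_mulInvariantVectorField hinv a a x
    change inner ℝ (L a) (L a) = _ at this
    rw [ha, inner_zero_left] at this
    exact inner_self_eq_zero.1 this.symm
  exact (LinearMap.injective_iff_surjective_of_finrank_eq_finrank rfl).1 hinj u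

section Connection

variable [IsContMDiffRiemannianBundle 𝓘(ℝ, E) ∞ E (fun x : N ↦ TangentSpace 𝓘(ℝ, E) x)]

/-- The affine connection `cov` (with Mathlib's convention `cov Y x (X x) = (∇_X Y)(x)`) is the
Levi-Civita connection of the metric: it is torsion free and compatible with the metric. -/
def IsLeviCivita (cov : CovariantDerivative 𝓘(ℝ, E) E (fun x : N ↦ TangentSpace 𝓘(ℝ, E) x)) :
    Prop :=
  cov.torsion = 0 ∧
    CovariantDerivative.IsMetricCompatible (V := fun x : N ↦ TangentSpace 𝓘(ℝ, E) x) cov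

theorem mdifferentiableAt_inner_mulInvariantVectorField
    {σ : ∀ x : N, TangentSpace 𝓘(ℝ, E) x} {x : N} (hσ : MDiffAt (T% σ) x)
    (a : GroupLieAlgebra 𝓘(ℝ, E) N) :
    MDiffAt (fun y : N ↦ inner ℝ (σ y) (mulInvariantVectorField a y)) x :=
  MDifferentiableAt.inner_bundle (E := fun x : N ↦ TangentSpace 𝓘(ℝ, E) x) hσ
    (mdifferentiableAt_mulInvariantVectorField a)

/-- A left invariant metric has a Levi-Civita connection. -/
theorem exists_isLeviCivita (hinv : IsLeftInvariantMetric E N) :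
    ∃ cov : CovariantDerivative 𝓘(ℝ, E) E (fun x : N ↦ TangentSpace 𝓘(ℝ, E) x),
      IsLeviCivita cov := by
  let L : (GroupLieAlgebra 𝓘(ℝ, E) N) → ∀ x : N, TangentSpace 𝓘(ℝ, E) x :=
    fun a x ↦ mulInvariantVectorField a x
  let e := stdOrthonormalBasis ℝ (GroupLieAlgebra 𝓘(ℝ, E) N)
  have hLadd : ∀ a b x, L (a + b) x = L a x + L b x := fun a b x ↦
    congrFun (mulInvariantVectorField_add a b) x
  have hLsmul : ∀ (c : ℝ) a x, L (c • a) x = c • L a x := fun c a x ↦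
    congrFun (mulInvariantVectorField_smul c a) x
  have hLin : ∀ a b x, inner ℝ (L a x) (L b x) = inner ℝ a b := fun a b x ↦
    inner_mulInvariantVectorField hinv a b x
  have hLsum : ∀ (f : Fin (Module.finrank ℝ (GroupLieAlgebra 𝓘(ℝ, E) N)) → ℝ) x,
      L (∑ i, f i • e i) x = ∑ i, f i • L (e i) x := by
    intro f x
    let L' : (GroupLieAlgebra 𝓘(ℝ, E) N) →ₗ[ℝ] TangentSpace 𝓘(ℝ, E) x := ⟨⟨(L · x), (hLadd · · x)⟩, (hLsmul · · x)⟩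
    have h : L' (∑ i, f i • e i) = ∑ i, L' (f i • e i) := map_sum L' _ _
    exact h.trans (Finset.sum_congr rfl fun i _ ↦ hLsmul _ _ _)
  have hexpg : ∀ a : (GroupLieAlgebra 𝓘(ℝ, E) N), a = ∑ i, inner ℝ a (e i) • e i := fun a ↦ by
    conv_lhs => rw [← e.sum_repr a]
    refine Finset.sum_congr rfl fun i _ ↦ ?_
    rw [e.repr_apply_apply, real_inner_comm]
  have hmd : ∀ a x, MDiffAt (T% (L a)) x := fun a x ↦ mdifferentiableAt_mulInvariantVectorField a
  have hLexp : ∀ a x, L a x = ∑ i, inner ℝ a (e i) • L (e i) x := fun a x ↦ by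
    conv_lhs => rw [hexpg a]
    exact hLsum _ x
  have hexp : ∀ (x : N) (s : TangentSpace 𝓘(ℝ, E) x),
      ∑ i, inner ℝ s (L (e i) x) • L (e i) x = s := by
    intro x s
    obtain ⟨a, rfl⟩ := exists_mulInvariantVectorField_eq hinv x s
    change ∑ i, inner ℝ (L a x) (L (e i) x) • L (e i) x = L a x
    simp only [hLin]
    exact (hLexp a x).symm
  -- the flat connection for which left invariant fields are parallel
  let flat : CovariantDerivative 𝓘(ℝ, E) E (fun x : N ↦ TangentSpace 𝓘(ℝ, E) x) :=
    { toFun := fun σ x ↦ ∑ i, (d% (fun y : N ↦ inner ℝ (σ y) (L (e i) y)) x).smulRight (L (e i) x)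
      isCovariantDerivativeOnUniv :=
        { add := by
            intro σ σ' x hσ hσ' _
            rw [← Finset.sum_add_distrib]
            refine Finset.sum_congr rfl fun i _ ↦ ?_
            have h := mvfderiv_fun_add
              (mdifferentiableAt_inner_mulInvariantVectorField hσ (e i))
              (mdifferentiableAt_inner_mulInvariantVectorField hσ' (e i))
            simp only [Pi.add_apply, inner_add_left]
            ext v
            simp [L, h, add_smul]
          leibniz := by
            intro σ g x hσ hg _
            conv_rhs => rw [← hexp x (σ x)]
            have h := fun i ↦ mvfderiv_fun_mul hg
              (mdifferentiableAt_inner_mulInvariantVectorField hσ (e i))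
            have h' : ∀ i, (d% (fun y : N ↦ inner ℝ ((g • σ) y) (L (e i) y)) x).smulRight
                (L (e i) x) = g x • (d% (fun y : N ↦ inner ℝ (σ y) (L (e i) y)) x).smulRight
                  (L (e i) x) + (d% g x).smulRight (inner ℝ (σ x) (L (e i) x) • L (e i) x) := by
              intro i
              simp only [Pi.smul_apply', real_inner_smul_left]
              rw [h i]
              ext v
              simp only [ContinuousLinearMap.smulRight_apply, add_apply,
                smul_apply, add_smul, smul_smul, smul_eq_mul]
              rw [mul_comm ((d% g x) v)]
            simp only [h', Finset.sum_add_distrib, Finset.smul_sum]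
            congr 1
            ext v
            simp [Finset.smul_sum] } }
  have hflat : ∀ a x, flat (L a) x = 0 := by
    intro a x
    change ∑ i, (d% (fun y : N ↦ inner ℝ (L a y) (L (e i) y)) x).smulRight (L (e i) x) = 0
    refine Finset.sum_eq_zero fun i _ ↦ ?_
    simp only [hLin]
    have h0 : (d% (fun _ : N ↦ (inner ℝ a (e i) : ℝ)) x) = 0 := by
      ext v
      simp [mvfderiv]
    rw [h0]
    ext v
    simp
  let Γ : (GroupLieAlgebra 𝓘(ℝ, E) N) → (GroupLieAlgebra 𝓘(ℝ, E) N) → (GroupLieAlgebra 𝓘(ℝ, E) N) → ℝ := fun a b c ↦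
    (inner ℝ ⁅a, b⁆ c - inner ℝ ⁅b, c⁆ a + inner ℝ ⁅c, a⁆ b) / 2
  let A : ∀ x : N, TangentSpace 𝓘(ℝ, E) x →L[ℝ] TangentSpace 𝓘(ℝ, E) x →L[ℝ]
      TangentSpace 𝓘(ℝ, E) x := fun x ↦
    ∑ i, ∑ j, ∑ k, (Γ (e k) (e j) (e i)) • (innerSL ℝ (L (e j) x)).smulRight
      ((innerSL ℝ (L (e k) x)).smulRight (L (e i) x))
  have hΓ₁ : ∀ (a b c : (GroupLieAlgebra 𝓘(ℝ, E) N)), Γ b a c = ∑ k, inner ℝ b (e k) * Γ (e k) a c := by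
    intro a b c
    let G : (GroupLieAlgebra 𝓘(ℝ, E) N) →ₗ[ℝ] ℝ :=
      { toFun := fun b ↦ Γ b a c
        map_add' := fun x y ↦ by simp only [Γ, add_lie, lie_add, inner_add_left, inner_add_right]; ring
        map_smul' := fun r x ↦ by
          simp only [Γ, smul_lie, lie_smul, real_inner_smul_left, real_inner_smul_right,
            smul_eq_mul, RingHom.id_apply]
          ring }
    have h : G (∑ k, inner ℝ b (e k) • e k) = ∑ k, G (inner ℝ b (e k) • e k) := map_sum G _ _
    rw [← hexpg b] at h
    simp only [map_smul, smul_eq_mul] at h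
    exact h
  have hΓ₂ : ∀ (a b c : (GroupLieAlgebra 𝓘(ℝ, E) N)), Γ b a c = ∑ j, inner ℝ a (e j) * Γ b (e j) c := by
    intro a b c
    let G : (GroupLieAlgebra 𝓘(ℝ, E) N) →ₗ[ℝ] ℝ :=
      { toFun := fun a ↦ Γ b a c
        map_add' := fun x y ↦ by simp only [Γ, add_lie, lie_add, inner_add_left, inner_add_right]; ring
        map_smul' := fun r x ↦ by
          simp only [Γ, smul_lie, lie_smul, real_inner_smul_left, real_inner_smul_right,
            smul_eq_mul, RingHom.id_apply]
          ring }
    have h : G (∑ k, inner ℝ a (e k) • e k) = ∑ k, G (inner ℝ a (e k) • e k) := map_sum G _ _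
    rw [← hexpg a] at h
    simp only [map_smul, smul_eq_mul] at h
    exact h
  have hA : ∀ a b x, A x (L a x) (L b x) = ∑ i, Γ b a (e i) • L (e i) x := by
    intro a b x
    simp only [A, sum_apply, smul_apply,
      ContinuousLinearMap.smulRight_apply, innerSL_apply_apply, hLin]
    refine Finset.sum_congr rfl fun i _ ↦ ?_
    rw [hΓ₂ a b (e i), Finset.sum_smul]
    refine Finset.sum_congr rfl fun j _ ↦ ?_
    rw [hΓ₁ (e j) b (e i), Finset.mul_sum, Finset.sum_smul]
    refine Finset.sum_congr rfl fun k _ ↦ ?_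
    simp only [smul_smul]
    rw [real_inner_comm a, real_inner_comm b]
    congr 1
    ring
  have hcov : ∀ a b x, (flat.addOneForm A) (L a) x (L b x) = ∑ i, Γ b a (e i) • L (e i) x := by
    intro a b x
    have h : (flat.addOneForm A) (L a) x = flat (L a) x + A x (L a x) := rfl
    rw [h, hflat, zero_add, hA]
  refine ⟨flat.addOneForm A, ?_, ?_⟩
  · ext x u v
    obtain ⟨a, rfl⟩ := exists_mulInvariantVectorField_eq hinv x u
    obtain ⟨b, rfl⟩ := exists_mulInvariantVectorField_eq hinv x v
    have hbr : VectorField.mlieBracket 𝓘(ℝ, E) (L a) (L b) x = L ⁅a, b⁆ x :=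
      (congrFun (mulInvariantVector_mlieBracket a b) x).symm
    have ht := CovariantDerivative.torsion_apply (flat.addOneForm A) (hmd a x) (hmd b x)
    change (flat.addOneForm A).torsion x (L a x) (L b x) = 0
    rw [ht, hcov, hcov, hbr, hLexp ⁅a, b⁆ x, ← Finset.sum_sub_distrib, ← Finset.sum_sub_distrib]
    refine Finset.sum_eq_zero fun i _ ↦ ?_
    rw [← sub_smul, ← sub_smul]
    have : Γ a b (e i) - Γ b a (e i) - inner ℝ ⁅a, b⁆ (e i) = 0 := by
      simp only [Γ]
      rw [← lie_skew b a, ← lie_skew (e i) a, ← lie_skew (e i) b]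
      simp only [inner_neg_left]
      ring
    rw [this, zero_smul]
  · have hΓc : ∀ a b c x, inner ℝ (∑ i, Γ b a (e i) • L (e i) x) (L c x) = Γ b a c := by
      intro a b c x
      rw [sum_inner]
      simp only [real_inner_smul_left, hLin]
      conv_rhs => rw [hexpg c]
      simp only [Γ, inner_sum, lie_sum, sum_lie, real_inner_smul_left, real_inner_smul_right, lie_smul, smul_lie, sum_inner]
      rw [← Finset.sum_sub_distrib, ← Finset.sum_add_distrib, Finset.sum_div]
      refine Finset.sum_congr rfl fun i _ ↦ ?_
      rw [real_inner_comm c]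
      ring
    ext x u v w
    obtain ⟨a, rfl⟩ := exists_mulInvariantVectorField_eq hinv x u
    obtain ⟨b, rfl⟩ := exists_mulInvariantVectorField_eq hinv x v
    obtain ⟨c, rfl⟩ := exists_mulInvariantVectorField_eq hinv x w
    have ht := CovariantDerivative.derivMetricTensor_apply
      (V := fun x : N ↦ TangentSpace 𝓘(ℝ, E) x) (flat.addOneForm A) (X := L c) x (hmd a x) (hmd b x)
    refine ht.trans ?_
    simp only [hcov, hLin, mvfderiv_const]
    rw [hΓc, real_inner_comm, hΓc]
    change (0 : ℝ) - _ - _ = 0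
    simp only [Γ]
    rw [← lie_skew b a, ← lie_skew c a, ← lie_skew c b]
    simp only [inner_neg_left]
    ring

/-- The Levi-Civita connection of a left invariant metric. -/
def leviCivita (hinv : IsLeftInvariantMetric E N) :
    CovariantDerivative 𝓘(ℝ, E) E (fun x : N ↦ TangentSpace 𝓘(ℝ, E) x) :=
  (exists_isLeviCivita hinv).choose

theorem isLeviCivita_leviCivita (hinv : IsLeftInvariantMetric E N) :
    IsLeviCivita (leviCivita hinv) :=
  (exists_isLeviCivita hinv).choose_spec

end Connection

/-- The inverse of left translation: a tangent vector at `x` is sent to the element `a` of the Lie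
algebra whose left invariant vector field takes that value at `x`. -/
def leftCoord (x : N) : TangentSpace 𝓘(ℝ, E) x →L[ℝ] GroupLieAlgebra 𝓘(ℝ, E) N :=
  (show GroupLieAlgebra 𝓘(ℝ, E) N →L[ℝ] TangentSpace 𝓘(ℝ, E) x from
    mfderiv 𝓘(ℝ, E) 𝓘(ℝ, E) (x * ·) (1 : N)).inverse

theorem leftCoord_mulInvariantVectorField (hinv : IsLeftInvariantMetric E N) (x : N)
    (a : GroupLieAlgebra 𝓘(ℝ, E) N) : leftCoord x (mulInvariantVectorField a x) = a := by
  let L : GroupLieAlgebra 𝓘(ℝ, E) N →L[ℝ] TangentSpace 𝓘(ℝ, E) x :=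
    mfderiv 𝓘(ℝ, E) 𝓘(ℝ, E) (x * ·) (1 : N)
  have hL : ∀ b, L b = mulInvariantVectorField b x := fun b ↦ rfl
  have hfd : FiniteDimensional ℝ (TangentSpace 𝓘(ℝ, E) x) := inferInstanceAs (FiniteDimensional ℝ E)
  have hinj : Function.Injective L := by
    rw [injective_iff_map_eq_zero]
    intro b hb
    have h := inner_mulInvariantVectorField hinv b b x
    rw [← hL, hb, inner_zero_left] at h
    exact inner_self_eq_zero.1 h.symm
  have hsurj : Function.Surjective L := exists_mulInvariantVectorField_eq hinv x
  let e : GroupLieAlgebra 𝓘(ℝ, E) N ≃L[ℝ] TangentSpace 𝓘(ℝ, E) x :=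
    (LinearEquiv.ofBijective L.toLinearMap ⟨hinj, hsurj⟩).toContinuousLinearEquiv
  have he : L = (e : GroupLieAlgebra 𝓘(ℝ, E) N →L[ℝ] TangentSpace 𝓘(ℝ, E) x) := by
    ext b; rfl
  change L.inverse (L a) = a
  rw [he, ContinuousLinearMap.inverse_equiv]
  exact e.symm_apply_apply a

/-- The velocity vector `γ'(t)` of a curve. -/
def velocity (γ : ℝ → N) (t : ℝ) : TangentSpace 𝓘(ℝ, E) (γ t) :=
  mfderiv 𝓘(ℝ, ℝ) 𝓘(ℝ, E) γ t (1 : ℝ)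

/-- A vector field `Y` along a curve, written `Y(t) = ∑ yᵢ(t) Eᵢ(γ(t))` in a global frame of left
invariant vector fields, is smooth if its coordinates `yᵢ` are. -/
def IsSmoothAlong (γ : ℝ → N) (Y : ∀ t : ℝ, TangentSpace 𝓘(ℝ, E) (γ t)) : Prop :=
  ContDiff ℝ ∞ (fun t ↦ leftCoord (γ t) (Y t))

/-- The covariant derivative `DY/dt` of a vector field `Y` along a curve `γ`. If
`Y(t) = ∑ yᵢ(t) Eᵢ(γ(t))` for a global frame of left invariant vector fields `Eᵢ`, then
`DY/dt = ∑ yᵢ'(t) Eᵢ(γ(t)) + ∑ yᵢ(t) ∇_{γ'(t)} Eᵢ`; here this is written without a basis, and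
`∑ yᵢ(t) Eᵢ` (with `t` frozen) is the left invariant vector field that agrees with `Y(t)` at
`γ(t)`. -/
def covDerivAlong (cov : CovariantDerivative 𝓘(ℝ, E) E (fun x : N ↦ TangentSpace 𝓘(ℝ, E) x))
    (γ : ℝ → N) (Y : ∀ t : ℝ, TangentSpace 𝓘(ℝ, E) (γ t)) (t : ℝ) : TangentSpace 𝓘(ℝ, E) (γ t) :=
  mulInvariantVectorField (deriv (fun s ↦ leftCoord (γ s) (Y s)) t) (γ t) +
    cov (mulInvariantVectorField (leftCoord (γ t) (Y t))) (γ t) (velocity γ t)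

/-- The curvature `R(X, Y) W = ∇_X ∇_Y W - ∇_Y ∇_X W - ∇_[X, Y] W` on vector fields. -/
def curvatureOnFields
    (cov : CovariantDerivative 𝓘(ℝ, E) E (fun x : N ↦ TangentSpace 𝓘(ℝ, E) x))
    (X Y W : ∀ x : N, TangentSpace 𝓘(ℝ, E) x) (x : N) : TangentSpace 𝓘(ℝ, E) x :=
  cov (fun y ↦ cov W y (Y y)) x (X x) - cov (fun y ↦ cov W y (X y)) x (Y x) -
    cov W x (VectorField.mlieBracket 𝓘(ℝ, E) X Y x)

/-- The curvature `R(u, v) w` on tangent vectors at `x`. Curvature is tensorial, so any smooth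
extension of the three vectors may be used; we take left invariant ones. -/
def curvatureAt (cov : CovariantDerivative 𝓘(ℝ, E) E (fun x : N ↦ TangentSpace 𝓘(ℝ, E) x))
    (x : N) (u v w : TangentSpace 𝓘(ℝ, E) x) : TangentSpace 𝓘(ℝ, E) x :=
  curvatureOnFields cov (mulInvariantVectorField (leftCoord x u))
    (mulInvariantVectorField (leftCoord x v)) (mulInvariantVectorField (leftCoord x w)) x

/-- A differentiable curve is a geodesic if its velocity field is smooth and parallel. -/
def IsGeodesic (cov : CovariantDerivative 𝓘(ℝ, E) E (fun x : N ↦ TangentSpace 𝓘(ℝ, E) x))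
    (γ : ℝ → N) : Prop :=
  MDifferentiable 𝓘(ℝ, ℝ) 𝓘(ℝ, E) γ ∧ IsSmoothAlong γ (velocity (E := E) γ) ∧
    ∀ t, covDerivAlong cov γ (velocity γ) t = 0

/-- Jacobi vector fields along `γ`: smooth solutions of `Y'' + R(Y, γ') γ' = 0`. -/
def IsJacobiField (cov : CovariantDerivative 𝓘(ℝ, E) E (fun x : N ↦ TangentSpace 𝓘(ℝ, E) x))
    (γ : ℝ → N) (Y : ∀ t : ℝ, TangentSpace 𝓘(ℝ, E) (γ t)) : Prop :=
  IsSmoothAlong γ Y ∧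
    ∀ t, covDerivAlong cov γ (covDerivAlong cov γ Y) t +
      curvatureAt cov (γ t) (Y t) (velocity γ t) (velocity γ t) = 0

/-- The points `γ a` and `γ b` are conjugate along `γ`: the curve `γ` is a geodesic, `a ≠ b`, and a
Jacobi vector field along `γ`, not identically zero, vanishes at `a` and at `b`. -/
def IsConjugateAlong (cov : CovariantDerivative 𝓘(ℝ, E) E (fun x : N ↦ TangentSpace 𝓘(ℝ, E) x))
    (γ : ℝ → N) (a b : ℝ) : Prop :=
  IsGeodesic cov γ ∧ a ≠ b ∧
    ∃ Y : ∀ t : ℝ, TangentSpace 𝓘(ℝ, E) (γ t),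
      IsJacobiField cov γ Y ∧ (∃ t, Y t ≠ 0) ∧ Y a = 0 ∧ Y b = 0

variable (E N) in
/-- The orthogonal complement `𝔙` of the center of the Lie algebra. -/
def centerOrthogonal : Submodule ℝ (GroupLieAlgebra 𝓘(ℝ, E) N) :=
  (LieAlgebra.center ℝ (GroupLieAlgebra 𝓘(ℝ, E) N)).toSubmoduleᗮ

/-- The linear functional `Y ↦ ⟨[X, Y], Z⟩` on `𝔙`. -/
def bracketFunctional (Z : GroupLieAlgebra 𝓘(ℝ, E) N) (X : centerOrthogonal E N) :
    centerOrthogonal E N →ₗ[ℝ] ℝ where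
  toFun Y := inner ℝ ⁅(X : GroupLieAlgebra 𝓘(ℝ, E) N), (Y : GroupLieAlgebra 𝓘(ℝ, E) N)⁆ Z
  map_add' Y Y' := by simp [inner_add_left]
  map_smul' c Y := by simp [real_inner_smul_left]

/-- The map `j(Z) : 𝔙 → 𝔙`, given by `⟨j(Z) X, Y⟩ = ⟨[X, Y], Z⟩` for all `X`, `Y` in `𝔙`. -/
def jMap (Z : GroupLieAlgebra 𝓘(ℝ, E) N) : centerOrthogonal E N →ₗ[ℝ] centerOrthogonal E N where
  toFun X := (InnerProductSpace.toDual ℝ (centerOrthogonal E N)).symm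
    (LinearMap.toContinuousLinearMap (bracketFunctional Z X))
  map_add' X X' := by
    rw [← map_add, ← map_add]
    congr 2
    ext Y
    simp [bracketFunctional, inner_add_left]
  map_smul' c X := by
    refine ext_inner_right ℝ fun Y ↦ ?_
    rw [RingHom.id_apply, real_inner_smul_left, InnerProductSpace.toDual_symm_apply,
      InnerProductSpace.toDual_symm_apply]
    simp [bracketFunctional, real_inner_smul_left]

theorem inner_jMap (Z : GroupLieAlgebra 𝓘(ℝ, E) N) (X Y : centerOrthogonal E N) :
    inner ℝ (jMap Z X) Y =
      inner ℝ ⁅(X : GroupLieAlgebra 𝓘(ℝ, E) N), (Y : GroupLieAlgebra 𝓘(ℝ, E) N)⁆ Z := by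
  change inner ℝ ((InnerProductSpace.toDual ℝ (centerOrthogonal E N)).symm _) Y = _
  rw [InnerProductSpace.toDual_symm_apply]
  rfl

end AlongCurves

end LeftInvariantGeometry

/-! A 2-step nilpotent Lie algebra has central derived algebra, so `Z` commutes with everything and
the Koszul formula collapses: with J denoting `j(Z)` extended by zero to the center, ∇_Z a = ∇_a Z =
-J a / 2 for left invariant fields. Since J Z = 0, the one-parameter subgroup of `Z` is a geodesic.

In left invariant coordinates y, covariant differentiation along this geodesic is d/dt - J/2, and
R(a, Z)Z = -J²a/4. Squaring the former produces J²y/4, which the curvature term cancels, so the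
Jacobi equation becomes y'' = J y' with constant coefficients
(`IsLeviCivita.isJacobiField_iff_of_central`).

The rest is linear algebra. J is skew, so J² is symmetric with eigenvalues at most 0. Components of
y along ker J are affine in time and vanish identically once they vanish at 0 and t. On an invariant
plane where J² = -r², a complex coordinate satisfies w'' = i r w', whose nonzero solutions with two
zeros at 0 and t exist only if exp(i r t) = 1 (`exists_period_of_deriv_deriv_eq`). Conversely
exp(sJ)a - a solves the equation and vanishes at all multiples of 2π/r. Finally, i r is a complex
eigenvalue of `j(Z)` exactly when -r² is an eigenvalue of its square. The second claim follows
because multiples of a period are periods. -/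

section SkewEndomorphisms

/-! ### Imaginary eigenvalues of a real endomorphism -/

open scoped TensorProduct

/-- For `r > 0`, the number `i r` is a complex eigenvalue of a real endomorphism `f` if and only if
`-r²` is an eigenvalue of `f ∘ f`. -/
theorem hasEigenvalue_baseChange_I_mul_iff {V : Type*} [AddCommGroup V] [Module ℝ V]
    (f : V →ₗ[ℝ] V) {r : ℝ} (hr : 0 < r) :
    Module.End.HasEigenvalue (LinearMap.baseChange ℂ f) (Complex.I * (r : ℂ)) ↔
      ∃ a : V, a ≠ 0 ∧ f (f a) = -(r ^ 2) • a := by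
  constructor
  · intro h
    obtain ⟨v, hv⟩ := h.exists_hasEigenvector
    by_contra! hcon
    -- If f² + r² were injective over ℝ, it would stay injective after the flat base change to ℂ;
    -- but it kills the eigenvector, since (i r)² + r² = 0.
    let g : V →ₗ[ℝ] V := f ∘ₗ f + (r ^ 2) • LinearMap.id
    have hg : Function.Injective g := by
      rw [injective_iff_map_eq_zero]
      intro a ha
      by_contra ha0
      refine hcon a ha0 ?_
      rw [neg_smul]
      exact eq_neg_of_add_eq_zero_left ha
    have hg' : Function.Injective (g.lTensor ℂ) :=
      Module.Flat.lTensor_preserves_injective_linearMap g hg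
    have hf := hv.apply_eq_smul
    have key : g.baseChange ℂ v = 0 := by
      have : g.baseChange ℂ v =
          f.baseChange ℂ (f.baseChange ℂ v) + (r ^ 2 : ℝ) • v := by
        simp [g, LinearMap.baseChange_add, LinearMap.baseChange_smul, LinearMap.baseChange_comp]
      rw [this, hf, map_smul, hf, smul_smul]
      have e : (r ^ 2 : ℝ) • v = ((r : ℂ) ^ 2) • v := by
        rw [← Complex.ofReal_pow]
        exact (algebraMap_smul ℂ (r ^ 2 : ℝ) v).symm
      rw [e, ← add_smul]
      have : Complex.I * (r : ℂ) * (Complex.I * r) + (r : ℂ) ^ 2 = 0 := by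
        linear_combination (r : ℂ) ^ 2 * Complex.I_mul_I
      rw [this, zero_smul]
    exact hv.2 (hg' (key.trans (map_zero _).symm))
  · rintro ⟨a, ha, hfa⟩
    -- This is (f + i r)a, and (f - i r)(f + i r)a = (f² + r²)a = 0.
    let v : ℂ ⊗[ℝ] V := (1 : ℂ) ⊗ₜ f a + (Complex.I * r) ⊗ₜ a
    refine Module.End.hasEigenvalue_of_hasEigenvector (x := v) ⟨?_, ?_⟩
    · rw [Module.End.mem_eigenspace_iff]
      have h1 : (1 : ℂ) ⊗ₜ[ℝ] (-(r ^ 2) • a) = (Complex.I * r * (Complex.I * r)) ⊗ₜ[ℝ] a := by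
        rw [← TensorProduct.smul_tmul]
        congr 1
        rw [Complex.real_smul]
        push_cast
        linear_combination -(r : ℂ) ^ 2 * Complex.I_mul_I
      simp only [v, map_add, LinearMap.baseChange_tmul, hfa, smul_add, TensorProduct.smul_tmul',
        smul_eq_mul, mul_one, h1]
      exact add_comm _ _
    · intro hv
      -- The imaginary part of `v` is r a, which is nonzero.
      have h := congrArg (fun w ↦ TensorProduct.lid ℝ V (Complex.imLm.rTensor V w)) hv
      simp only [v, map_add, LinearMap.rTensor_tmul, TensorProduct.lid_tmul, map_zero] at h
      simp at h
      exact h.elim (fun h ↦ hr.ne' h) ha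

/-! ### The equation y'' = J y' for a skew endomorphism J -/

variable {V : Type*} [NormedAddCommGroup V] [InnerProductSpace ℝ V]

/-- The curve `(cos (r s) - 1) a + (sin (r s) / r) J a`. -/
noncomputable def rotationCurve (J : V →ₗ[ℝ] V) (a : V) (r s : ℝ) : V :=
  (Real.cos (r * s) - 1) • a + (Real.sin (r * s) / r) • J a

theorem contDiff_rotationCurve (J : V →ₗ[ℝ] V) (a : V) (r : ℝ) :
    ContDiff ℝ ∞ (rotationCurve J a r) := by
  unfold rotationCurve
  fun_prop

theorem deriv_rotationCurve (J : V →ₗ[ℝ] V) (a : V) {r : ℝ} (hr : r ≠ 0) :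
    deriv (rotationCurve J a r) =
      fun s ↦ (-(r * Real.sin (r * s))) • a + Real.cos (r * s) • J a := by
  ext s
  have hl : HasDerivAt (fun s ↦ r * s) r s := by simpa using (hasDerivAt_id s).const_mul r
  have h1 : HasDerivAt (fun s ↦ Real.cos (r * s) - 1) (-(r * Real.sin (r * s))) s := by
    simpa [mul_comm] using (hl.cos).sub_const 1
  have h2 : HasDerivAt (fun s ↦ Real.sin (r * s) / r) (Real.cos (r * s)) s := by
    simpa [hr] using (hl.sin).div_const r
  exact ((h1.smul_const a).add (h2.smul_const (J a))).deriv

/-- When J²a = -r²a, the curve is exp(sJ)a - a, so its velocity exp(sJ)Ja is carried along by the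
flow of J. -/
theorem deriv_deriv_rotationCurve {J : V →ₗ[ℝ] V} {a : V} {r : ℝ} (hr : r ≠ 0)
    (ha : J (J a) = -(r ^ 2) • a) (s : ℝ) :
    deriv (deriv (rotationCurve J a r)) s = J (deriv (rotationCurve J a r) s) := by
  have hl : HasDerivAt (fun s ↦ r * s) r s := by simpa using (hasDerivAt_id s).const_mul r
  have h1 : HasDerivAt (fun s ↦ -(r * Real.sin (r * s))) (-(r * (Real.cos (r * s) * r))) s :=
    ((hl.sin).const_mul r).neg
  have h2 : HasDerivAt (fun s ↦ Real.cos (r * s)) (-Real.sin (r * s) * r) s := hl.cos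
  rw [deriv_rotationCurve J a hr]
  refine ((h1.smul_const a).add (h2.smul_const (J a))).deriv.trans ?_
  simp only [map_add, map_smul, ha, smul_smul]
  rw [add_comm]
  congr 2 <;> ring

theorem rotationCurve_zero (J : V →ₗ[ℝ] V) (a : V) (r : ℝ) : rotationCurve J a r 0 = 0 := by
  simp [rotationCurve]

theorem rotationCurve_period (J : V →ₗ[ℝ] V) (a : V) {r : ℝ} (hr : r ≠ 0) (m : ℕ) :
    rotationCurve J a r (2 * m * Real.pi / r) = 0 := by
  have h : r * (2 * m * Real.pi / r) = m * (2 * Real.pi) := by field_simp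
  have hs : Real.sin (m * (2 * Real.pi)) = 0 := by
    have := Real.sin_nat_mul_pi (2 * m)
    push_cast at this
    rw [← this]; ring_nf
  simp [rotationCurve, h, hs, Real.cos_nat_mul_two_pi]

/-- At half a period the value is -2a, which shows that the associated Jacobi field is not
identically zero. -/
theorem rotationCurve_half_period_ne_zero (J : V →ₗ[ℝ] V) {a : V} (ha : a ≠ 0) {r : ℝ}
    (hr : r ≠ 0) : rotationCurve J a r (Real.pi / r) ≠ 0 := by
  have h : r * (Real.pi / r) = Real.pi := by field_simp
  simp only [rotationCurve, h, Real.cos_pi, Real.sin_pi, zero_div, zero_smul, add_zero]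
  exact smul_ne_zero (by norm_num) ha

/-- A solution of `w'' = i r w'` vanishing at `0` and at `t` vanishes identically unless `r t` is a
multiple of `2π`. -/
theorem eq_zero_of_hasDerivAt_I_mul {w w' : ℝ → ℂ} {r t : ℝ} (hr : r ≠ 0)
    (hw : ∀ s, HasDerivAt w (w' s) s) (hw' : ∀ s, HasDerivAt w' (Complex.I * r * w' s) s)
    (h0 : w 0 = 0) (ht : w t = 0) (hper : Complex.exp (r * t * Complex.I) ≠ 1) (s : ℝ) :
    w s = 0 := by
  have hIr : Complex.I * (r : ℂ) ≠ 0 := mul_ne_zero Complex.I_ne_zero (by exact_mod_cast hr)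
  -- first integral `w' - i r w`
  have hc : ∀ s, w' s = Complex.I * r * w s + w' 0 := by
    intro s
    have hd : ∀ s, HasDerivAt (fun s ↦ w' s - Complex.I * r * w s) 0 s := fun s ↦ by
      exact ((hw' s).sub ((hw s).const_mul (Complex.I * r))).congr_deriv (sub_self _)
    have := is_const_of_deriv_eq_zero (fun s ↦ (hd s).differentiableAt)
      (fun s ↦ (hd s).deriv) s 0
    simp only [h0] at this
    linear_combination this
  have he : ∀ s : ℝ, HasDerivAt (fun s : ℝ ↦ Complex.exp (-(r * s * Complex.I)))
      (Complex.exp (-(r * s * Complex.I)) * (-(r * Complex.I))) s := by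
    intro s
    refine HasDerivAt.cexp ?_
    have := ((Complex.ofRealCLM.hasDerivAt (x := s)).const_mul (r : ℂ)).mul_const Complex.I
    rw [Complex.ofRealCLM_apply, Complex.ofReal_one, mul_one] at this
    exact this.neg
  -- The integrating factor exp(-i r s) makes w' constant.
  have hconst : ∀ s : ℝ, w' s = Complex.exp (r * s * Complex.I) * w' 0 := by
    intro s
    have hd : ∀ s : ℝ, HasDerivAt (fun s : ℝ ↦ Complex.exp (-(r * s * Complex.I)) * w' s) 0 s :=
      fun s ↦ by
        refine ((he s).mul (hw' s)).congr_deriv ?_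
        ring
    have := is_const_of_deriv_eq_zero (fun s ↦ (hd s).differentiableAt)
      (fun s ↦ (hd s).deriv) s 0
    simp only [Complex.ofReal_zero, mul_zero, zero_mul, neg_zero, Complex.exp_zero, one_mul] at this
    rw [← this, ← mul_assoc, ← Complex.exp_add]
    simp
  -- At time t, where w vanishes, the first integral gives w'(t) = w'(0), while w'(t) = exp(i r t)
  -- w'(0) with exp(i r t) ≠ 1.
  have hw0 : w' 0 = 0 := by
    have h1 := hc t
    rw [ht, mul_zero, zero_add, hconst t] at h1
    by_contra hne
    exact hper (mul_right_cancel₀ hne (h1.trans (one_mul _).symm))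
  have h2 := hc s
  rw [hconst s, hw0, mul_zero, add_zero] at h2
  exact (mul_eq_zero.1 h2.symm).resolve_left hIr

variable [FiniteDimensional ℝ V]

/-- If `J` is skew-symmetric and `y'' = J y'` has a nontrivial solution vanishing at `0` and at
`t > 0`, then `t` is a period of the rotation of a `J`-invariant plane. -/
theorem exists_period_of_deriv_deriv_eq {J : V →ₗ[ℝ] V}
    (hJ : ∀ x y, inner ℝ (J x) y = -inner ℝ x (J y)) {y y' : ℝ → V}
    (hy : ∀ s, HasDerivAt y (y' s) s) (hy' : ∀ s, HasDerivAt y' (J (y' s)) s) {t : ℝ}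
    (ht : 0 < t) (h0 : y 0 = 0) (hyt : y t = 0) (hne : ∃ s, y s ≠ 0) :
    ∃ (m : ℕ) (r : ℝ), 0 < m ∧ 0 < r ∧ (∃ a : V, a ≠ 0 ∧ J (J a) = -(r ^ 2) • a) ∧
      t = 2 * m * Real.pi / r := by
  have hin : ∀ e s, HasDerivAt (fun s ↦ inner ℝ (y s) e) (inner ℝ (y' s) e) s := fun e s ↦ by
    simpa using (hy s).inner ℝ (hasDerivAt_const s e)
  have hin' : ∀ e s, HasDerivAt (fun s ↦ inner ℝ (y' s) e) (-inner ℝ (y' s) (J e)) s :=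
    fun e s ↦ by
      have := (hy' s).inner ℝ (hasDerivAt_const s e)
      rw [hJ] at this
      simpa using this
  -- The two signs of skewness cancel in J², which therefore has a real orthonormal eigenbasis. One
  -- basis vector along which y has a nonzero component is enough.
  have hS : (J ∘ₗ J).IsSymmetric := fun x z ↦ by
    simp only [LinearMap.comp_apply, hJ, neg_neg]
  let e := hS.eigenvectorBasis rfl
  let μ := hS.eigenvalues rfl
  have hμ : ∀ i, J (J (e i)) = μ i • e i := fun i ↦ hS.apply_eigenvectorBasis rfl i
  have he : ∀ i, e i ≠ 0 := fun i ↦ e.toBasis.ne_zero i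
  obtain ⟨s, hs⟩ := hne
  obtain ⟨i, hi⟩ : ∃ i, inner ℝ (y s) (e i) ≠ (0 : ℝ) := by
    by_contra! hcon
    refine hs (e.repr.injective ?_)
    ext i
    rw [e.repr_apply_apply, real_inner_comm, hcon i, map_zero]
    rfl
  have hnorm : inner ℝ (J (e i)) (J (e i)) = -μ i := by
    have h1 := hJ (J (e i)) (e i)
    rw [hμ, real_inner_smul_left, e.inner_eq_one] at h1
    linarith
  have hμneg : μ i < 0 := by
    have hle : μ i ≤ 0 := by
      have := real_inner_self_nonneg (x := J (e i))
      linarith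
    refine hle.lt_of_ne fun hz ↦ hi ?_
    rw [hz, neg_zero, inner_self_eq_zero] at hnorm
    -- the component along the kernel of `J` is affine
    have h1 : ∀ s, inner ℝ (y' s) (e i) = (inner ℝ (y' 0) (e i) : ℝ) := fun s ↦
      is_const_of_deriv_eq_zero (fun s ↦ (hin' (e i) s).differentiableAt)
        (fun s ↦ by rw [(hin' (e i) s).deriv, hnorm, inner_zero_right, neg_zero]) s 0
    set c : ℝ := inner ℝ (y' 0) (e i)
    have h2 : ∀ s, inner ℝ (y s) (e i) = s * c := fun s ↦ by
      have hd : ∀ s, HasDerivAt (fun s ↦ inner ℝ (y s) (e i) - s * c) 0 s := fun s ↦ by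
        refine ((hin (e i) s).sub ((hasDerivAt_id s).mul_const c)).congr_deriv ?_
        rw [h1 s, one_mul, sub_self]
      have := is_const_of_deriv_eq_zero (fun s ↦ (hd s).differentiableAt)
        (fun s ↦ (hd s).deriv) s 0
      simp only [h0, inner_zero_left, zero_mul, sub_zero] at this
      linarith
    have h3 := h2 t
    rw [hyt, inner_zero_left] at h3
    have h4 : c = 0 := (mul_eq_zero.1 h3.symm).resolve_left ht.ne'
    rw [h2 s, h4, mul_zero]
  let r := Real.sqrt (-μ i)
  have hr : 0 < r := Real.sqrt_pos.2 (by linarith)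
  have hr2 : r ^ 2 = -μ i := Real.sq_sqrt (by linarith)
  have hJJ : J (J (e i)) = -(r ^ 2) • e i := by rw [hμ, hr2, neg_neg]
  -- Complex coordinate of y on the J-invariant plane of e i and J (e i). Since |J (e i)| = r,
  -- dividing by r makes the frame orthonormal, and J acts as multiplication by i r.
  let w : ℝ → ℂ := fun s ↦
    (inner ℝ (y s) (e i) : ℝ) + ((inner ℝ (y s) (J (e i)) / r : ℝ)) * Complex.I
  let w' : ℝ → ℂ := fun s ↦
    (inner ℝ (y' s) (e i) : ℝ) + ((inner ℝ (y' s) (J (e i)) / r : ℝ)) * Complex.I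
  have hw : ∀ s, HasDerivAt w (w' s) s := fun s ↦
    (hin (e i) s).ofReal_comp.add
      ((((hin (J (e i)) s).div_const r).ofReal_comp).mul_const Complex.I)
  have hw' : ∀ s, HasDerivAt w' (Complex.I * r * w' s) s := fun s ↦ by
    refine ((hin' (e i) s).ofReal_comp.add
      ((((hin' (J (e i)) s).div_const r).ofReal_comp).mul_const Complex.I)).congr_deriv ?_
    have hrc : (r : ℂ) ≠ 0 := by exact_mod_cast hr.ne'
    simp only [w', hJJ, real_inner_smul_right]
    push_cast
    field_simp
    linear_combination -(inner ℝ (y' s) (J (e i)) : ℂ) * Complex.I_sq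
  have hper : Complex.exp (r * t * Complex.I) = 1 := by
    by_contra hper
    have := eq_zero_of_hasDerivAt_I_mul hr.ne' hw hw' (by simp [w, h0]) (by simp [w, hyt]) hper s
    refine hi ?_
    have := congrArg Complex.re this
    simpa [w] using this
  obtain ⟨n, hn⟩ := Complex.exp_eq_one_iff.1 hper
  have hn' : r * t = n * (2 * Real.pi) := by
    have := congrArg Complex.im hn
    simpa using this
  have hnpos : 0 < n := by
    have h1 : 0 < (n : ℝ) * (2 * Real.pi) := hn' ▸ mul_pos hr ht
    exact_mod_cast pos_of_mul_pos_left h1 Real.two_pi_pos.le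
  lift n to ℕ using hnpos.le
  refine ⟨n, r, by exact_mod_cast hnpos, hr, ⟨e i, he i, hJJ⟩, ?_⟩
  rw [eq_div_iff hr.ne']
  push_cast at hn'
  linarith

end SkewEndomorphisms

/-! ### Connection and curvature in the direction of a central element -/

section LeftInvariantJacobi

variable {E : Type*} [NormedAddCommGroup E] [NormedSpace ℝ E] [FiniteDimensional ℝ E]
  {N : Type*} [TopologicalSpace N] [ChartedSpace E N] [Group N] [LieGroup 𝓘(ℝ, E) ∞ N]
  [RiemannianBundle (fun x : N ↦ TangentSpace 𝓘(ℝ, E) x)]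

/-- The map `j(Z)`, extended by zero on the center to the whole Lie algebra. -/
noncomputable def jExtended (Z : GroupLieAlgebra 𝓘(ℝ, E) N) :
    GroupLieAlgebra 𝓘(ℝ, E) N →ₗ[ℝ] GroupLieAlgebra 𝓘(ℝ, E) N :=
  (centerOrthogonal E N).subtype ∘ₗ jMap Z ∘ₗ
    (centerOrthogonal E N).orthogonalProjectionOnto.toLinearMap

theorem jExtended_mem (Z x : GroupLieAlgebra 𝓘(ℝ, E) N) :
    jExtended Z x ∈ centerOrthogonal E N :=
  Subtype.property _

theorem jExtended_coe (Z : GroupLieAlgebra 𝓘(ℝ, E) N) (x : centerOrthogonal E N) :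
    jExtended Z (x : GroupLieAlgebra 𝓘(ℝ, E) N) = jMap Z x := by
  simp [jExtended]

/-- Every vector differs from its projection to 𝔙 by a central one, which brackets do not see. Thus
the identity defining `jMap` holds on the whole Lie algebra and projections need not be carried
along. -/
theorem inner_jExtended (Z x y : GroupLieAlgebra 𝓘(ℝ, E) N) :
    inner ℝ (jExtended Z x) y = inner ℝ ⁅x, y⁆ Z := by
  have hsub : ∀ w : GroupLieAlgebra 𝓘(ℝ, E) N,
      w - (centerOrthogonal E N).orthogonalProjectionOnto w ∈
        LieAlgebra.center ℝ (GroupLieAlgebra 𝓘(ℝ, E) N) := by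
    intro w
    have h := (centerOrthogonal E N).sub_starProjection_mem_orthogonal w
    rw [centerOrthogonal, Submodule.orthogonal_orthogonal] at h
    exact h
  have hc : ∀ z ∈ LieAlgebra.center ℝ (GroupLieAlgebra 𝓘(ℝ, E) N),
      ∀ w : GroupLieAlgebra 𝓘(ℝ, E) N, ⁅z, w⁆ = 0 := fun z hz w ↦ by
    rw [← lie_skew, (LieModule.mem_maxTrivSubmodule _ _ _ z).1 hz w, neg_zero]
  have hc' : ∀ z ∈ LieAlgebra.center ℝ (GroupLieAlgebra 𝓘(ℝ, E) N),
      ∀ w : GroupLieAlgebra 𝓘(ℝ, E) N, ⁅w, z⁆ = 0 := fun z hz w ↦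
    (LieModule.mem_maxTrivSubmodule _ _ _ z).1 hz w
  have h1 := hc _ (hsub x) ((centerOrthogonal E N).orthogonalProjectionOnto y)
  rw [sub_lie, sub_eq_zero] at h1
  have h2 := hc' _ (hsub y) x
  rw [lie_sub, sub_eq_zero] at h2
  have h3 : inner ℝ (jExtended Z x) (y - (centerOrthogonal E N).orthogonalProjectionOnto y) =
      (0 : ℝ) :=
    (centerOrthogonal E N).inner_right_of_mem_orthogonal (jExtended_mem Z x)
      ((centerOrthogonal E N).sub_starProjection_mem_orthogonal y)
  rw [inner_sub_right, sub_eq_zero] at h3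
  rw [h3, h2, h1, ← inner_jMap]
  rfl

theorem inner_jExtended_left (Z x y : GroupLieAlgebra 𝓘(ℝ, E) N) :
    inner ℝ (jExtended Z x) y = -inner ℝ x (jExtended Z y) := by
  rw [real_inner_comm, real_inner_comm _ x, real_inner_comm, inner_jExtended, inner_jExtended,
    ← lie_skew, inner_neg_left]

/-- Extending by zero adds only kernel: an eigenvector of the square with nonzero eigenvalue lies in
the image, hence in 𝔙. -/
theorem exists_jExtended_sq_iff (Z : GroupLieAlgebra 𝓘(ℝ, E) N) {r : ℝ} (hr : r ≠ 0) :
    (∃ a, a ≠ 0 ∧ jExtended Z (jExtended Z a) = -(r ^ 2) • a) ↔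
      ∃ a, a ≠ 0 ∧ jMap Z (jMap Z a) = -(r ^ 2) • a := by
  constructor
  · rintro ⟨a, ha, h⟩
    have hmem : a ∈ centerOrthogonal E N := by
      have h' := jExtended_mem Z (jExtended Z a)
      rw [h] at h'
      exact ((centerOrthogonal E N).smul_mem_iff (neg_ne_zero.2 (pow_ne_zero 2 hr))).1 h'
    lift a to centerOrthogonal E N using hmem
    rw [jExtended_coe, jExtended_coe] at h
    exact ⟨a, fun h0 ↦ ha (by rw [h0]; rfl), Subtype.ext h⟩
  · rintro ⟨a, ha, h⟩
    refine ⟨a, fun h0 ↦ ha (Subtype.ext h0), ?_⟩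
    rw [jExtended_coe, jExtended_coe, h]
    rfl

/-- In a 2-step nilpotent Lie algebra the derived algebra is central. -/
theorem lie_eq_zero_of_mem_derived {L : Type*} [LieRing L] [LieAlgebra ℝ L]
    (hL : IsTwoStepNilpotent L) {Z : L}
    (hZ : Z ∈ (⁅(⊤ : LieIdeal ℝ L), (⊤ : LieIdeal ℝ L)⁆ : LieIdeal ℝ L)) (x : L) :
    ⁅x, Z⁆ = 0 := by
  have hle : ⁅(⊤ : LieIdeal ℝ L), (⊤ : LieIdeal ℝ L)⁆ ≤ LieAlgebra.center ℝ L := by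
    rw [LieSubmodule.lieIdeal_oper_eq_span, LieSubmodule.lieSpan_le]
    rintro _ ⟨u, v, rfl⟩
    refine (LieModule.mem_maxTrivSubmodule _ _ _ _).2 fun w ↦ ?_
    rw [← lie_skew, neg_eq_zero]
    exact hL.1 _ _ _
  exact (LieModule.mem_maxTrivSubmodule _ _ _ Z).1 (hle hZ) x

section Connection

variable [IsContMDiffRiemannianBundle 𝓘(ℝ, E) ∞ E (fun x : N ↦ TangentSpace 𝓘(ℝ, E) x)]
  {cov : CovariantDerivative 𝓘(ℝ, E) E (fun x : N ↦ TangentSpace 𝓘(ℝ, E) x)}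

/-- The Koszul formula for left invariant vector fields. -/
theorem IsLeviCivita.inner_mulInvariantVectorField (hcov : IsLeviCivita cov)
    (hinv : IsLeftInvariantMetric E N) (a b c : GroupLieAlgebra 𝓘(ℝ, E) N) (x : N) :
    inner ℝ (cov (mulInvariantVectorField a) x (mulInvariantVectorField b x))
      (mulInvariantVectorField c x) =
      (inner ℝ ⁅b, a⁆ c - inner ℝ ⁅a, c⁆ b + inner ℝ ⁅c, b⁆ a) / 2 := by
  let L : (GroupLieAlgebra 𝓘(ℝ, E) N) → ∀ x : N, TangentSpace 𝓘(ℝ, E) x :=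
    fun a x ↦ mulInvariantVectorField a x
  let G : (GroupLieAlgebra 𝓘(ℝ, E) N) → (GroupLieAlgebra 𝓘(ℝ, E) N) →
      (GroupLieAlgebra 𝓘(ℝ, E) N) → ℝ := fun b a c ↦ inner ℝ (cov (L a) x (L b x)) (L c x)
  have hmd : ∀ a x, MDiffAt (T% (L a)) x := fun a x ↦ mdifferentiableAt_mulInvariantVectorField a
  have hin : ∀ a b x, inner ℝ (L a x) (L b x) = inner ℝ a b := fun a b x ↦
    _root_.inner_mulInvariantVectorField hinv a b x
  have ht : ∀ a b c, G b a c - G a b c = inner ℝ ⁅b, a⁆ c := by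
    intro a b c
    have h : cov (L a) x (L b x) - cov (L b) x (L a x) =
        VectorField.mlieBracket 𝓘(ℝ, E) (L b) (L a) x :=
      (CovariantDerivative.torsion_eq_zero_iff _).1 hcov.1 (hmd b x) (hmd a x)
    have hbr : VectorField.mlieBracket 𝓘(ℝ, E) (L b) (L a) x = L ⁅b, a⁆ x :=
      (congrFun (mulInvariantVector_mlieBracket b a) x).symm
    rw [hbr] at h
    simp only [G]
    rw [← inner_sub_left, h, hin]
  -- Inner products of left invariant fields are constant, so the derivative term in metric
  -- compatibility vanishes.
  have hm : ∀ a b c, G b a c + G b c a = 0 := by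
    intro a b c
    have h := CovariantDerivative.IsMetricCompatible.mvfderiv_inner_eq hcov.2 (L b)
      (hmd a x) (hmd c x)
    have h0 : (d% (fun y : N ↦ (inner ℝ (L a y) (L c y) : ℝ)) x) (L b x) = 0 := by
      simp only [hin, mvfderiv_const]
      rfl
    have h' := h0.symm.trans h
    simp only [G]
    rw [real_inner_comm (L a x)]
    exact h'.symm
  change G b a c = _
  -- The usual Koszul elimination: torsion and compatibility for the permutations of a, b, c
  -- determine G linearly.
  have t1 := ht a b c
  have t2 := ht c a b
  have t3 := ht b c a
  have m1 := hm a b c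
  have m2 := hm b a c
  have m3 := hm a c b
  linarith

/-- If `Z` is central then `∇_Z a = ∇_a Z = -j(Z) a / 2` for left invariant vector fields. -/
theorem IsLeviCivita.apply_mulInvariantVectorField_of_central (hcov : IsLeviCivita cov)
    (hinv : IsLeftInvariantMetric E N) {Z : GroupLieAlgebra 𝓘(ℝ, E) N}
    (hZ : ∀ a : GroupLieAlgebra 𝓘(ℝ, E) N, ⁅a, Z⁆ = 0) (a : GroupLieAlgebra 𝓘(ℝ, E) N) (x : N) :
    cov (mulInvariantVectorField a) x (mulInvariantVectorField Z x) =
        mulInvariantVectorField ((-1 / 2 : ℝ) • jExtended Z a) x ∧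
      cov (mulInvariantVectorField Z) x (mulInvariantVectorField a x) =
        mulInvariantVectorField ((-1 / 2 : ℝ) • jExtended Z a) x := by
  have hZ' : ∀ a : GroupLieAlgebra 𝓘(ℝ, E) N, ⁅Z, a⁆ = 0 := fun a ↦ by
    rw [← lie_skew, hZ, neg_zero]
  constructor
  all_goals
    refine ext_inner_right ℝ fun v ↦ ?_
    obtain ⟨c, rfl⟩ := exists_mulInvariantVectorField_eq hinv x v
    -- Brackets with Z vanish, so in both cases the Koszul formula retains a single term, -⟨[a, c],
    -- Z⟩ / 2.
    rw [hcov.inner_mulInvariantVectorField hinv, _root_.inner_mulInvariantVectorField hinv,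
      real_inner_smul_left, inner_jExtended, hZ, hZ']
    try rw [← lie_skew a c]
    simp only [inner_zero_left, inner_neg_left]
    ring

/-- Since ∇_Z Z = -J Z / 2 = 0 and [a, Z] = 0, only -∇_Z ∇_a Z survives in R(a, Z)Z; two factors
-1/2 give the constant. -/
theorem IsLeviCivita.curvatureAt_of_central (hcov : IsLeviCivita cov)
    (hinv : IsLeftInvariantMetric E N) {Z : GroupLieAlgebra 𝓘(ℝ, E) N}
    (hZ : ∀ a : GroupLieAlgebra 𝓘(ℝ, E) N, ⁅a, Z⁆ = 0) (a : GroupLieAlgebra 𝓘(ℝ, E) N) (x : N) :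
    curvatureAt cov x (mulInvariantVectorField a x) (mulInvariantVectorField Z x)
      (mulInvariantVectorField Z x) =
        mulInvariantVectorField ((-1 / 4 : ℝ) • jExtended Z (jExtended Z a)) x := by
  have hL := fun b y ↦ (hcov.apply_mulInvariantVectorField_of_central hinv hZ b y).1
  have hR := fun b y ↦ (hcov.apply_mulInvariantVectorField_of_central hinv hZ b y).2
  have hJZ : jExtended Z Z = 0 := ext_inner_right ℝ fun v ↦ by
    rw [inner_jExtended, ← lie_skew, hZ, neg_zero, inner_zero_left, inner_zero_left]
  have hz : ∀ y : N, (mulInvariantVectorField (0 : GroupLieAlgebra 𝓘(ℝ, E) N) y :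
      TangentSpace 𝓘(ℝ, E) y) = 0 := fun y ↦ map_zero _
  have hbr : VectorField.mlieBracket 𝓘(ℝ, E) (mulInvariantVectorField a)
      (mulInvariantVectorField Z) x = mulInvariantVectorField ⁅a, Z⁆ x :=
    (congrFun (mulInvariantVector_mlieBracket a Z) x).symm
  have h1 : (fun y : N ↦ cov (mulInvariantVectorField Z) y (mulInvariantVectorField Z y)) =
      mulInvariantVectorField (0 : GroupLieAlgebra 𝓘(ℝ, E) N) := by
    funext y
    rw [hL, hJZ, smul_zero]
  have h2 : (fun y : N ↦ cov (mulInvariantVectorField Z) y (mulInvariantVectorField a y)) =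
      mulInvariantVectorField ((-1 / 2 : ℝ) • jExtended Z a) := funext fun y ↦ hR a y
  have h3 : cov (mulInvariantVectorField (0 : GroupLieAlgebra 𝓘(ℝ, E) N)) x = 0 := by
    have : mulInvariantVectorField (0 : GroupLieAlgebra 𝓘(ℝ, E) N) = 0 := funext hz
    rw [this]
    exact congrFun cov.zero x
  rw [curvatureAt, leftCoord_mulInvariantVectorField hinv, leftCoord_mulInvariantVectorField hinv,
    curvatureOnFields, hbr, h1, h2, h3, hL, hZ, hz]
  simp only [map_zero, zero_sub, sub_zero, zero_apply, map_smul, smul_smul]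
  have : ∀ b, (mulInvariantVectorField (-b) x : TangentSpace 𝓘(ℝ, E) x) =
      -mulInvariantVectorField b x := fun b ↦ map_neg _ b
  rw [← this, ← neg_smul]
  norm_num

end Connection

end LeftInvariantJacobi

/-! ### Jacobi fields along a central one-parameter subgroup -/

section OneParameterSubgroups

variable {E : Type*} [NormedAddCommGroup E] [NormedSpace ℝ E]
  {N : Type*} [TopologicalSpace N] [ChartedSpace E N] [Group N]

theorem velocity_of_isMIntegralCurve {γ : ℝ → N} {Z : GroupLieAlgebra 𝓘(ℝ, E) N}
    (hγ : IsMIntegralCurve γ (mulInvariantVectorField Z)) (t : ℝ) :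
    velocity γ t = mulInvariantVectorField Z (γ t) := by
  rw [velocity, (hγ t).mfderiv]
  exact one_smul ℝ _

variable [FiniteDimensional ℝ E] [LieGroup 𝓘(ℝ, E) ∞ N]
  [RiemannianBundle (fun x : N ↦ TangentSpace 𝓘(ℝ, E) x)]

theorem mulInvariantVectorField_leftCoord (hinv : IsLeftInvariantMetric E N) (x : N)
    (u : TangentSpace 𝓘(ℝ, E) x) : mulInvariantVectorField (leftCoord x u) x = u := by
  obtain ⟨a, rfl⟩ := exists_mulInvariantVectorField_eq hinv x u
  rw [leftCoord_mulInvariantVectorField hinv]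

variable
  [IsContMDiffRiemannianBundle 𝓘(ℝ, E) ∞ E (fun x : N ↦ TangentSpace 𝓘(ℝ, E) x)]
  {cov : CovariantDerivative 𝓘(ℝ, E) E (fun x : N ↦ TangentSpace 𝓘(ℝ, E) x)}

/-- The velocity is the left invariant field of Z, so the connection term is ∇_Z, that is, -J/2. -/
theorem IsLeviCivita.leftCoord_covDerivAlong (hcov : IsLeviCivita cov)
    (hinv : IsLeftInvariantMetric E N) {Z : GroupLieAlgebra 𝓘(ℝ, E) N}
    (hZ : ∀ a : GroupLieAlgebra 𝓘(ℝ, E) N, ⁅a, Z⁆ = 0) {γ : ℝ → N}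
    (hγ : IsMIntegralCurve γ (mulInvariantVectorField Z))
    (Y : ∀ t : ℝ, TangentSpace 𝓘(ℝ, E) (γ t)) (t : ℝ) :
    leftCoord (γ t) (covDerivAlong cov γ Y t) =
      deriv (fun s ↦ leftCoord (γ s) (Y s)) t -
        (1 / 2 : ℝ) • jExtended Z (leftCoord (γ t) (Y t)) := by
  rw [covDerivAlong, velocity_of_isMIntegralCurve hγ,
    (hcov.apply_mulInvariantVectorField_of_central hinv hZ _ _).1, map_add,
    leftCoord_mulInvariantVectorField hinv, leftCoord_mulInvariantVectorField hinv, sub_eq_add_neg,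
    ← neg_smul]
  norm_num

/-- In left invariant coordinates the velocity is the constant Z, and J Z = 0. -/
theorem IsLeviCivita.isGeodesic_of_central (hcov : IsLeviCivita cov)
    (hinv : IsLeftInvariantMetric E N) {Z : GroupLieAlgebra 𝓘(ℝ, E) N}
    (hZ : ∀ a : GroupLieAlgebra 𝓘(ℝ, E) N, ⁅a, Z⁆ = 0) {γ : ℝ → N}
    (hγ : IsMIntegralCurve γ (mulInvariantVectorField Z)) : IsGeodesic cov γ := by
  have hc : (fun t ↦ leftCoord (γ t) (velocity (E := E) γ t)) = fun _ ↦ Z := by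
    funext t
    rw [velocity_of_isMIntegralCurve hγ, leftCoord_mulInvariantVectorField hinv]
  refine ⟨fun t ↦ (hγ t).mdifferentiableAt, ?_, fun t ↦ ?_⟩
  · rw [IsSmoothAlong, hc]
    exact contDiff_const
  · rw [← mulInvariantVectorField_leftCoord hinv (γ t) (covDerivAlong _ _ _ _),
      hcov.leftCoord_covDerivAlong hinv hZ hγ, hc, deriv_const, congrFun hc t]
    have hJZ : jExtended Z Z = 0 := ext_inner_right ℝ fun v ↦ by
      rw [inner_jExtended, ← lie_skew, hZ, neg_zero, inner_zero_left, inner_zero_left]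
    rw [hJZ, smul_zero, sub_zero]
    exact map_zero _

/-- In left invariant coordinates, the Jacobi equation along the one-parameter subgroup of a central
element `Z` is `y'' = j(Z) y'`. -/
theorem IsLeviCivita.isJacobiField_iff_of_central (hcov : IsLeviCivita cov)
    (hinv : IsLeftInvariantMetric E N) {Z : GroupLieAlgebra 𝓘(ℝ, E) N}
    (hZ : ∀ a : GroupLieAlgebra 𝓘(ℝ, E) N, ⁅a, Z⁆ = 0) {γ : ℝ → N}
    (hγ : IsMIntegralCurve γ (mulInvariantVectorField Z))
    {Y : ∀ t : ℝ, TangentSpace 𝓘(ℝ, E) (γ t)} {y : ℝ → GroupLieAlgebra 𝓘(ℝ, E) N}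
    (hy : ∀ t, leftCoord (γ t) (Y t) = y t) :
    IsJacobiField cov γ Y ↔
      ContDiff ℝ ∞ y ∧ ∀ t, deriv (deriv y) t = jExtended Z (deriv y t) := by
  obtain rfl : (fun t ↦ leftCoord (γ t) (Y t)) = y := funext hy
  set y := fun t ↦ leftCoord (γ t) (Y t)
  refine and_congr_right fun hsm ↦ forall_congr' fun t ↦ ?_
  have hsm : ContDiff ℝ ∞ y := hsm
  have hy1 : ∀ t, HasDerivAt y (deriv y t) t := fun t ↦
    (hsm.differentiable (by simp) t).hasDerivAt
  have hy2 : HasDerivAt (deriv y) (deriv (deriv y) t) t :=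
    ((contDiff_infty_iff_deriv.1 hsm).2.differentiable (by simp) t).hasDerivAt
  have hJ : HasDerivAt (fun s ↦ jExtended Z (y s)) (jExtended Z (deriv y t)) t :=
    (LinearMap.toContinuousLinearMap (jExtended Z)).hasFDerivAt.comp_hasDerivAt t (hy1 t)
  have hD : (fun s ↦ leftCoord (γ s) (covDerivAlong cov γ Y s)) =
      fun s ↦ deriv y s - (1 / 2 : ℝ) • jExtended Z (y s) :=
    funext fun s ↦ hcov.leftCoord_covDerivAlong hinv hZ hγ Y s
  -- The square of d/dt - J/2. Its J²/4 is cancelled by the curvature below, leaving y'' - J y'.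
  have hDD : leftCoord (γ t) (covDerivAlong cov γ (covDerivAlong cov γ Y) t) =
      deriv (deriv y) t - jExtended Z (deriv y t) +
        (1 / 4 : ℝ) • jExtended Z (jExtended Z (y t)) := by
    rw [hcov.leftCoord_covDerivAlong hinv hZ hγ, congrFun hD t, hD,
      HasDerivAt.deriv (hy2.fun_sub (hJ.fun_const_smul (1 / 2 : ℝ))), map_sub, map_smul]
    module
  have hR : leftCoord (γ t) (curvatureAt cov (γ t) (Y t) (velocity γ t) (velocity γ t)) =
      (-1 / 4 : ℝ) • jExtended Z (jExtended Z (y t)) := by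
    rw [velocity_of_isMIntegralCurve hγ, ← mulInvariantVectorField_leftCoord hinv (γ t) (Y t),
      hcov.curvatureAt_of_central hinv hZ, leftCoord_mulInvariantVectorField hinv]
  have hsum : leftCoord (γ t) (covDerivAlong cov γ (covDerivAlong cov γ Y) t +
      curvatureAt cov (γ t) (Y t) (velocity γ t) (velocity γ t)) =
        deriv (deriv y) t - jExtended Z (deriv y t) := by
    rw [map_add, hDD, hR]
    module
  rw [← sub_eq_zero (a := deriv (deriv y) t), ← hsum]
  constructor
  · intro h
    rw [h, map_zero]
  -- A tangent vector is recovered from its left invariant coordinate, so the equation in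
  -- coordinates implies the one on N.
  · intro h
    rw [← mulInvariantVectorField_leftCoord hinv (γ t) (_ + _), h]
    exact map_zero _

theorem IsLeviCivita.isConjugateAlong_iff_of_central (hcov : IsLeviCivita cov)
    (hinv : IsLeftInvariantMetric E N) {Z : GroupLieAlgebra 𝓘(ℝ, E) N}
    (hZ : ∀ a : GroupLieAlgebra 𝓘(ℝ, E) N, ⁅a, Z⁆ = 0) {γ : ℝ → N}
    (hγ : IsMIntegralCurve γ (mulInvariantVectorField Z)) {t : ℝ} (ht : 0 < t) :
    IsConjugateAlong cov γ 0 t ↔ ∃ (m : ℕ) (r : ℝ), 0 < m ∧ 0 < r ∧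
      Module.End.HasEigenvalue (LinearMap.baseChange ℂ (jMap Z)) (Complex.I * (r : ℂ)) ∧
      t = 2 * m * Real.pi / r := by
  constructor
  · rintro ⟨-, -, Y, hY, ⟨s, hs⟩, h0, h1⟩
    let y : ℝ → GroupLieAlgebra 𝓘(ℝ, E) N := fun t ↦ leftCoord (γ t) (Y t)
    obtain ⟨hsm, hode⟩ :=
      (hcov.isJacobiField_iff_of_central hinv hZ hγ (y := y) fun _ ↦ rfl).1 hY
    have hy1 : ∀ t, HasDerivAt y (deriv y t) t := fun t ↦
      (hsm.differentiable (by simp) t).hasDerivAt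
    have hy2 : ∀ t, HasDerivAt (deriv y) (jExtended Z (deriv y t)) t := fun t ↦
      hode t ▸ ((contDiff_infty_iff_deriv.1 hsm).2.differentiable (by simp) t).hasDerivAt
    have hys : y s ≠ 0 := fun h ↦ hs <| by
      rw [← mulInvariantVectorField_leftCoord hinv (γ s) (Y s)]
      exact (congrArg (mulInvariantVectorField · (γ s)) h).trans (map_zero _)
    have hz : ∀ t, Y t = 0 → y t = 0 := fun t h ↦ by simp only [y, h, map_zero]
    obtain ⟨m, r, hm, hr, ha, htr⟩ := exists_period_of_deriv_deriv_eq (inner_jExtended_left Z)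
      hy1 hy2 ht (hz 0 h0) (hz t h1) ⟨s, hys⟩
    exact ⟨m, r, hm, hr, (hasEigenvalue_baseChange_I_mul_iff _ hr).2
      ((exists_jExtended_sq_iff Z hr.ne').1 ha), htr⟩
  · rintro ⟨m, r, hm, hr, heig, rfl⟩
    obtain ⟨a, ha, hJa⟩ := (exists_jExtended_sq_iff Z hr.ne').2
      ((hasEigenvalue_baseChange_I_mul_iff _ hr).1 heig)
    -- The witness is the Jacobi field with coordinates exp(sJ)a - a, nonzero at the half period
    -- π/r.
    refine ⟨hcov.isGeodesic_of_central hinv hZ hγ, ht.ne,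
      fun s ↦ mulInvariantVectorField (rotationCurve (jExtended Z) a r s) (γ s), ?_,
      ⟨Real.pi / r, fun h ↦ ?_⟩, ?_, ?_⟩
    · exact (hcov.isJacobiField_iff_of_central hinv hZ hγ
        fun s ↦ leftCoord_mulInvariantVectorField hinv _ _).2
        ⟨contDiff_rotationCurve _ _ _, deriv_deriv_rotationCurve hr.ne' hJa⟩
    · refine rotationCurve_half_period_ne_zero (jExtended Z) ha hr.ne' ?_
      rw [← leftCoord_mulInvariantVectorField hinv (γ (Real.pi / r)) (rotationCurve _ _ _ _)]
      exact (congrArg _ h).trans (map_zero _)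
    · simp only [rotationCurve_zero]
      exact map_zero _
    · simp only [rotationCurve_period _ _ hr.ne']
      exact map_zero _

end OneParameterSubgroups

/-! ### Conjugate points in the direction of the derived algebra -/

theorem proposition4p1
    {E : Type*} [NormedAddCommGroup E] [NormedSpace ℝ E] [FiniteDimensional ℝ E]
    {N : Type*} [TopologicalSpace N] [T2Space N] [SimplyConnectedSpace N]
    [ChartedSpace E N] [Group N] [LieGroup 𝓘(ℝ, E) ∞ N]
    [RiemannianBundle (fun x : N ↦ TangentSpace 𝓘(ℝ, E) x)]
    [IsContMDiffRiemannianBundle 𝓘(ℝ, E) ∞ E (fun x : N ↦ TangentSpace 𝓘(ℝ, E) x)]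
    (hinv : IsLeftInvariantMetric E N)
    (hnil : IsTwoStepNilpotent (GroupLieAlgebra 𝓘(ℝ, E) N))
    (Z : GroupLieAlgebra 𝓘(ℝ, E) N)
    (hZ : Z ∈ (⁅(⊤ : LieIdeal ℝ (GroupLieAlgebra 𝓘(ℝ, E) N)),
      (⊤ : LieIdeal ℝ (GroupLieAlgebra 𝓘(ℝ, E) N))⁆ : LieIdeal ℝ (GroupLieAlgebra 𝓘(ℝ, E) N)))
    (hZ0 : Z ≠ 0) :
    (∀ t : ℝ, 0 < t →
      (IsConjugateAlong (leviCivita hinv) (fun s : ℝ ↦ lieExp (s • Z)) 0 t ↔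
        ∃ (m : ℕ) (r : ℝ), 0 < m ∧ 0 < r ∧
          Module.End.HasEigenvalue (LinearMap.baseChange ℂ (jMap Z)) (Complex.I * (r : ℂ)) ∧
          t = 2 * m * Real.pi / r)) ∧
    (∀ t : ℝ, 0 < t →
      IsConjugateAlong (leviCivita hinv) (fun s : ℝ ↦ lieExp (s • Z)) 0 t →
      ∀ m : ℕ, 0 < m →
        IsConjugateAlong (leviCivita hinv) (fun s : ℝ ↦ lieExp (s • Z)) 0 (m * t)) := by
  have hcentral := lie_eq_zero_of_mem_derived hnil hZ
  have hiff := fun (t : ℝ) (ht : 0 < t) ↦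
    (isLeviCivita_leviCivita hinv).isConjugateAlong_iff_of_central hinv hcentral
      (isMIntegralCurve_lieExp Z).2 ht
  refine ⟨hiff, fun t ht hconj m hm ↦ ?_⟩
  -- If t = 2kπ/r, then m t = 2(mk)π/r, with the same eigenvalue i r.
  obtain ⟨k, r, hk, hr, heig, rfl⟩ := (hiff t ht).1 hconj
  refine (hiff _ (by positivity)).2 ⟨m * k, r, Nat.mul_pos hm hk, hr, heig, ?_⟩
  push_cast
  ring
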